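/- Let $K\in\mathbb N_0$, $A\in\mathbb R^{K\times K}$, $b\in\mathbb R^K$, $\sigma_z\ge 0$, $\mu_0\in\mathbb R^K$, and let $V_w,P_0\in\mathbb R^{K\times K}$ be symmetric positive semidefinite. Let $$x_{t+1}=Ax_t+w_t,\qquad y_t=b^\top x_t+z_t,\qquad t=0,1,2,\dots,$$ where $x_0\sim\mathcal N(\mu_0,P_0)$, $w_t\sim\mathcal N(0,V_w)$, $z_t\sim\mathcal N(0,\sigma_z^2)$, and all of $x_0,w_0,w_1,\dots,z_0,z_1,\dots$ are mutually independent. (The stationary process is the case $\rho(A)<1$, $\mu_0=0$, $P_0=V_x$ with $V_x=AV_xA^\top+V_w$.) A policy at time $t$ is a measurable map $\pi:\mathbb R^{t+1}\to\mathbb R$; it outputs $\chi_t=\pi(y_0,\dots,y_t)$, and its computation MSE is the $[0,\infty]$-valued random variable $$\mathsf{CMSE}_t(\pi)=\mathsf E\Big[\big|\chi_t-\mathbf 1^\top x_t\big|^2\,\Big|\,y_0,\dots,y_t\Big].$$ Define the Kalman filter by $\hat x_{0|-1}=\mu_0$, $M_{0|-1}=P_0$ and, for $t\ge 1$, $$\hat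 x_{t|t-1}=A\hat x_{t-1},\qquad M_{t|t-1}=AM_{t-1}A^\top+V_w,$$ and, for $t\ge0$, $$K_t=M_{t|t-1}b\,(\sigma_z^2+b^\top M_{t|t-1}b)^{-1},\quad \hat x_t=\hat x_{t|t-1}+K_t(y_t-b^\top\hat x_{t|t-1}),\quad M_t=(I-K_tb^\top)M_{t|t-1}$$ (with the convention $0^{-1}=0$, which matters only if $\sigma_z=0$). Then for every $t\ge 0$ the policy with output $\mathbf 1^\top\hat x_t$ minimizes the computation MSE: for every policy $\pi$, its computation MSE is almost surely at most $\mathsf{CMSE}_t(\pi)$, and any policy $\pi$ whose computation MSE almost surely equals this minimum has output $\mathbf 1^\top\hat x_t$ almost surely. The minimum computation MSE is almost surely equal to the nonnegative constant $\mathbf 1^\top M_t\mathbf 1$, and $M_t$ is the error covariance of the filter: $\mathsf E[(\hat x_t-x_t)(\hat x_t-x_t)^\top\mid y_0,\dots,y_t]=M_t$ almost surely. -/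

import Mathlib

open MeasureTheory ProbabilityTheory Matrix
open scoped NNReal ENNReal

namespace AirComp

/-- The parameters of the system with `K` sensors: process matrix `A`, process-noise covariance
`Vw`, Tx-scaling vector `b` (channel coefficients absorbed), receiver-noise variance `σ2`, and the
mean `μ₀` and covariance `P₀` of the initial signal vector. -/
structure Params (K : ℕ) where
  A : Matrix (Fin K) (Fin K) ℝ
  Vw : Matrix (Fin K) (Fin K) ℝ
  b : Fin K → ℝ
  σ2 : ℝ≥0
  μ₀ : Fin K → ℝ
  P₀ : Matrix (Fin K) (Fin K) ℝ
  Vw_posSemidef : Vw.PosSemidef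
  P₀_posSemidef : P₀.PosSemidef

/-- The Gauss-Markov signals `x`, driven by the process noise `w`, and the received signals `y`
with receiver noise `z`, on the probability space `(Ω, P)`. The last four fields say that
`x 0, w 0, w 1, …, z 0, z 1, …` are mutually independent. -/
structure IsGaussMarkovModel {K : ℕ} (S : Params K) {Ω : Type*} [MeasurableSpace Ω]
    (P : Measure Ω) (x w : ℕ → Ω → Fin K → ℝ) (y z : ℕ → Ω → ℝ) : Prop where
  state : ∀ t ω, x (t + 1) ω = S.A *ᵥ x t ω + w t ω
  observation : ∀ t ω, y t ω = S.b ⬝ᵥ x t ω + z t ω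
  measurable_init : Measurable (x 0)
  measurable_w : ∀ t, Measurable (w t)
  measurable_z : ∀ t, Measurable (z t)
  law_init : HasLaw (fun ω => WithLp.toLp 2 (x 0 ω))
    (multivariateGaussian (WithLp.toLp 2 S.μ₀) S.P₀) P
  law_w : ∀ t, HasLaw (fun ω => WithLp.toLp 2 (w t ω)) (multivariateGaussian 0 S.Vw) P
  law_z : ∀ t, HasLaw (z t) (gaussianReal 0 S.σ2) P
  iIndep_w : iIndepFun w P
  iIndep_z : iIndepFun z P
  indep_init_w : IndepFun (x 0) (fun ω t => w t ω) P
  indep_init_w_z : IndepFun (fun ω => (x 0 ω, fun t => w t ω)) (fun ω t => z t ω) P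

/-- The received signals `y_0, …, y_t`. -/
def history {Ω : Type*} (y : ℕ → Ω → ℝ) (t : ℕ) (ω : Ω) : Fin (t + 1) → ℝ :=
  fun s => y s ω

/-- The σ-algebra generated by `y_0, …, y_t`. -/
abbrev historyAlgebra {Ω : Type*} (y : ℕ → Ω → ℝ) (t : ℕ) : MeasurableSpace Ω :=
  MeasurableSpace.comap (history y t) inferInstance

/-- The computation MSE at time `t` of the policy `π`, which outputs `π (y_0, …, y_t)` as its
estimate of the sum of the signals: the conditional expectation of the squared error given
`y_0, …, y_t`. It takes values in `[0, ∞]`, so that no integrability of `π` is needed. -/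
noncomputable def cmse {K : ℕ} {Ω : Type*} [MeasurableSpace Ω] (P : Measure Ω)
    (x : ℕ → Ω → Fin K → ℝ) (y : ℕ → Ω → ℝ) (t : ℕ) (π : (Fin (t + 1) → ℝ) → ℝ) :
    Ω → ℝ≥0∞ :=
  condLExp (historyAlgebra y t) P
    (fun ω => ENNReal.ofReal (|π (history y t ω) - ∑ k, x t ω k| ^ 2))

namespace Params

variable {K : ℕ} (S : Params K)

/-- The gain `N b (σ² + bᵀ N b)⁻¹`, where `N` is the prediction MSE matrix. -/
noncomputable def gain (N : Matrix (Fin K) (Fin K) ℝ) : Fin K → ℝ :=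
  ((S.σ2 : ℝ) + S.b ⬝ᵥ (N *ᵥ S.b))⁻¹ • (N *ᵥ S.b)

/-- The matrix `(I - k bᵀ) N`, where `k` is the gain belonging to `N`. -/
noncomputable def correctCov (N : Matrix (Fin K) (Fin K) ℝ) : Matrix (Fin K) (Fin K) ℝ :=
  (1 - vecMulVec (S.gain N) S.b) * N

/-- The prediction MSE matrix `M_{t|t-1}`; at time `0` it is the prior covariance. -/
noncomputable def predCov : ℕ → Matrix (Fin K) (Fin K) ℝ
  | 0 => S.P₀
  | t + 1 => S.A * S.correctCov (predCov t) * S.Aᵀ + S.Vw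

/-- The estimation MSE matrix `M_t = (I - K_t bᵀ) M_{t|t-1}`. -/
noncomputable def cov (t : ℕ) : Matrix (Fin K) (Fin K) ℝ :=
  S.correctCov (S.predCov t)

/-- The Kalman gain vector `K_t`. -/
noncomputable def kalmanGain (t : ℕ) : Fin K → ℝ :=
  S.gain (S.predCov t)

/-- The correction of the prediction `p` at time `t` by the received signal `v`. -/
noncomputable def correct (t : ℕ) (p : Fin K → ℝ) (v : ℝ) : Fin K → ℝ :=
  p + (v - S.b ⬝ᵥ p) • S.kalmanGain t

/-- The Kalman estimate of the signal vector at time `t` as a function of the received signals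
`y_0, …, y_t`; the prediction is the prior mean at time `0`, and `A` times the previous estimate
afterwards. -/
noncomputable def estimate : (t : ℕ) → (Fin (t + 1) → ℝ) → Fin K → ℝ
  | 0, h => S.correct 0 S.μ₀ (h 0)
  | t + 1, h => S.correct (t + 1) (S.A *ᵥ estimate t (Fin.init h)) (h (Fin.last (t + 1)))

/-- The policy that outputs the sum of the Kalman estimate. -/
noncomputable def kalmanPolicy (t : ℕ) (h : Fin (t + 1) → ℝ) : ℝ :=
  ∑ k, S.estimate t h k

end Params

end AirComp

/-! The filter error `e = x t - S.estimate t (history y t)` is a centered Gaussian vector with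
covariance `S.cov t`, independent of the whole history (`filterError`). For any policy, output minus
`1ᵀx_t` equals (output minus `1ᵀx̂_t`) minus `1ᵀe`: a function of the history plus an independent
centered variable. The conditional second moment is therefore the square of the first term plus the
constant `1ᵀM_t1` (`condLExp_ofReal_add_sq`, `cmse_eq`). Optimality, uniqueness and the minimum
value can be read off this identity, and independence makes the conditional error covariance equal
to the unconditional one.

Independence propagates by induction. The prediction error `A e + w` is again independent of the
past. The gain makes the corrected error uncorrelated with the innovation `ν = bᵀX + Z`, where `X`
is the prediction error; joint Gaussianity turns this into independence
(`IsCenteredGaussian.correct`). Past and innovation together determine the new history. -/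

namespace AirComp

/-! ### Independence of pairs, and conditional second moments under independence -/

section Independence

variable {Ω α β γ : Type*} [MeasurableSpace Ω] [MeasurableSpace α] [MeasurableSpace β]
  [MeasurableSpace γ] {P : Measure Ω}
  {X : Ω → α} {Y : Ω → β} {Z : Ω → γ}

theorem indepFun_of_measurable_comap (h : IndepFun X Y P)
    (hZ : Measurable[MeasurableSpace.comap X inferInstance] Z) : IndepFun Z Y P := by
  rw [IndepFun_iff_Indep] at h ⊢
  exact indep_of_indep_of_le_left h hZ.comap_le

variable [IsProbabilityMeasure P]

/-- If `(X, Y)` is independent of `Z` and `X` is independent of `Y`, then `X` is independent of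
`(Y, Z)`. -/
theorem indepFun_prodMk_right (hX : Measurable X) (hY : Measurable Y) (hZ : Measurable Z)
    (hXY : IndepFun X Y P) (hXYZ : IndepFun (fun ω => (X ω, Y ω)) Z P) :
    IndepFun X (fun ω => (Y ω, Z ω)) P := by
  have hYZ : IndepFun Y Z P := hXYZ.comp (φ := Prod.snd) (ψ := id) measurable_snd measurable_id
  rw [indepFun_iff_map_prod_eq_prod_map_map (by fun_prop) (by fun_prop)] at hXY hXYZ hYZ ⊢
  rw [hYZ]
  have : IsProbabilityMeasure (P.map X) := Measure.isProbabilityMeasure_map (by fun_prop)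
  have : IsProbabilityMeasure (P.map Y) := Measure.isProbabilityMeasure_map (by fun_prop)
  have : IsProbabilityMeasure (P.map Z) := Measure.isProbabilityMeasure_map (by fun_prop)
  -- Both joint laws are the triple product of the marginals, up to reassociation.
  rw [← Measure.prodAssoc_prod, ← hXY, ← hXYZ, Measure.map_map (by fun_prop) (by fun_prop)]
  rfl

/-- If `X` is independent of `(Y, Z)` and `Y` is independent of `Z`, then `(X, Y)` is independent
of `Z`. -/
theorem indepFun_prodMk_left (hX : Measurable X) (hY : Measurable Y) (hZ : Measurable Z)
    (hYZ : IndepFun Y Z P) (hXYZ : IndepFun X (fun ω => (Y ω, Z ω)) P) :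
    IndepFun (fun ω => (X ω, Y ω)) Z P := by
  have h : IndepFun Z (fun ω => (Y ω, X ω)) P :=
    indepFun_prodMk_right hZ hY hX hYZ.symm
      (hXYZ.symm.comp (φ := Prod.swap) (ψ := id) measurable_swap measurable_id)
  exact h.symm.comp (φ := Prod.swap) (ψ := id) measurable_swap measurable_id

/-- The conditional expectation, given `Y`, of the squared distance of a function of `Y` to a
centered square-integrable variable that is independent of `Y`. -/
theorem condLExp_ofReal_add_sq {s : Ω → ℝ} {g : β → ℝ} (hY : Measurable Y) (hs : Measurable s)
    (hg : Measurable g) (hs2 : MemLp s 2 P) (hmean : ∫ ω, s ω ∂P = 0) (hind : IndepFun Y s P) :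
    condLExp (MeasurableSpace.comap Y inferInstance) P
        (fun ω => ENNReal.ofReal ((g (Y ω) + s ω) ^ 2))
      =ᵐ[P] fun ω => ENNReal.ofReal (g (Y ω) ^ 2 + ∫ ω', s ω' ^ 2 ∂P) := by
  refine (ae_eq_condLExp hY.comap_le P _ ?_ ?_).symm
  · have : Measurable fun y => ENNReal.ofReal (g y ^ 2 + ∫ ω', s ω' ^ 2 ∂P) := by fun_prop
    exact this.comp (comap_measurable Y)
  · rintro _ ⟨B, hB, rfl⟩
    -- With the value of `Y` frozen at `y`, the cross term vanishes because `s` has mean zero.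
    have hinner : ∀ y, ∫⁻ r, ENNReal.ofReal ((g y + r) ^ 2) ∂(P.map s)
        = ENNReal.ofReal (g y ^ 2 + ∫ ω', s ω' ^ 2 ∂P) := by
      intro y
      have hsi : Integrable s P := hs2.integrable (by norm_num)
      have hsq : Integrable (fun ω => s ω ^ 2) P := hs2.integrable_sq
      rw [lintegral_map (by fun_prop) hs]
      have hexp : ∀ ω, (g y + s ω) ^ 2 = (g y ^ 2 + 2 * g y * s ω) + s ω ^ 2 := fun ω => by ring
      rw [← ofReal_integral_eq_lintegral_ofReal]
      · congr 1
        simp_rw [hexp]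
        rw [integral_add (f := fun ω => g y ^ 2 + 2 * g y * s ω)
            ((integrable_const _).add (hsi.const_mul _)) hsq,
          integral_add (integrable_const _) (hsi.const_mul _), integral_const_mul, hmean]
        simp
      · simp_rw [hexp]
        exact ((integrable_const _).add (hsi.const_mul _)).add hsq
      · exact ae_of_all _ fun ω => sq_nonneg _
    have hprod := (indepFun_iff_map_prod_eq_prod_map_map hY.aemeasurable hs.aemeasurable).1 hind
    have : IsProbabilityMeasure (P.map s) := Measure.isProbabilityMeasure_map (by fun_prop)
    have : IsProbabilityMeasure (P.map Y) := Measure.isProbabilityMeasure_map (by fun_prop)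
    -- The indicator of `B ×ˢ univ` turns the integral over `Y ⁻¹' B` into one against the joint
    -- law, a product by independence, so Tonelli applies. No integrability of `g ∘ Y` is needed.
    have hF : Measurable fun p : β × ℝ =>
        (B ×ˢ Set.univ).indicator (fun p : β × ℝ => ENNReal.ofReal ((g p.1 + p.2) ^ 2)) p :=
      Measurable.indicator (by fun_prop) (hB.prod MeasurableSet.univ)
    have hright : ∫⁻ ω in Y ⁻¹' B, ENNReal.ofReal ((g (Y ω) + s ω) ^ 2) ∂P
        = ∫⁻ p, (B ×ˢ Set.univ).indicator
          (fun p : β × ℝ => ENNReal.ofReal ((g p.1 + p.2) ^ 2)) p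
            ∂(P.map fun ω => (Y ω, s ω)) := by
      rw [lintegral_map hF (by fun_prop), ← lintegral_indicator (hY hB)]
      refine lintegral_congr fun ω => ?_
      by_cases h : Y ω ∈ B <;> simp [Set.indicator, h]
    rw [hright, hprod, lintegral_prod _ hF.aemeasurable, ← lintegral_indicator (hY hB)]
    have hleft : ∀ ω, (Y ⁻¹' B).indicator
          (fun ω => ENNReal.ofReal (g (Y ω) ^ 2 + ∫ ω', s ω' ^ 2 ∂P)) ω
        = (fun y => ∫⁻ r, (B ×ˢ Set.univ).indicator
          (fun p : β × ℝ => ENNReal.ofReal ((g p.1 + p.2) ^ 2)) (y, r) ∂(P.map s)) (Y ω) := by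
      intro ω
      by_cases h : Y ω ∈ B <;> simp [Set.indicator, h, hinner]
    rw [lintegral_congr hleft, lintegral_map hF.lintegral_prod_right' hY]

end Independence

/-! ### Centered Gaussian vectors: the prediction and correction steps -/

section Gaussian

variable {K : ℕ} {Ω : Type*} [MeasurableSpace Ω] {P : Measure Ω}

/-- `X` is a Gaussian vector with mean zero and covariance matrix `N`. -/
structure IsCenteredGaussian (P : Measure Ω) (X : Ω → Fin K → ℝ) (N : Matrix (Fin K) (Fin K) ℝ) :
    Prop where
  measurable : Measurable X
  gaussian : HasGaussianLaw X P
  mean : ∀ i, ∫ ω, X ω i ∂P = 0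
  covariance : ∀ i j, cov[fun ω => X ω i, fun ω => X ω j; P] = N i j

namespace IsCenteredGaussian

variable {X : Ω → Fin K → ℝ} {N : Matrix (Fin K) (Fin K) ℝ}

theorem memLp (h : IsCenteredGaussian P X N) (i : Fin K) : MemLp (fun ω => X ω i) 2 P :=
  (h.gaussian.eval i).memLp_two

theorem integrable (h : IsCenteredGaussian P X N) (i : Fin K) : Integrable (fun ω => X ω i) P :=
  (h.gaussian.eval i).integrable

theorem measurable_apply (h : IsCenteredGaussian P X N) (i : Fin K) :
    Measurable (fun ω => X ω i) := measurable_pi_iff.1 h.measurable i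

theorem symm (h : IsCenteredGaussian P X N) (i j : Fin K) : N i j = N j i := by
  rw [← h.covariance, ← h.covariance, covariance_comm]

theorem of_hasLaw {m : Fin K → ℝ} (hN : N.PosSemidef) (hX : Measurable X)
    (h : HasLaw (fun ω => WithLp.toLp 2 (X ω)) (multivariateGaussian (WithLp.toLp 2 m) N) P) :
    IsCenteredGaussian P (fun ω => X ω - m) N := by
  have hg : HasGaussianLaw X P :=
    h.hasGaussianLaw.map_equiv (PiLp.continuousLinearEquiv 2 ℝ (fun _ : Fin K => ℝ))
  have : IsProbabilityMeasure P := hg.isProbabilityMeasure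
  have hint : ∀ i, Integrable (fun ω => X ω i) P := fun i => (hg.eval i).integrable
  have hmean : ∀ i, ∫ ω, X ω i ∂P = m i := by
    intro i
    have h1 : ∫ v, v i ∂(multivariateGaussian (WithLp.toLp 2 m) N) = m i := by
      have := (PiLp.proj (𝕜 := ℝ) 2 (fun _ : Fin K => ℝ) i).integral_comp_comm
        (IsGaussian.integrable_id (μ := multivariateGaussian (WithLp.toLp 2 m) N))
      simpa using this
    rw [← h.map_eq, integral_map h.aemeasurable (by fun_prop)] at h1
    exact h1
  refine ⟨by fun_prop, ?_, fun i => ?_, fun i j => ?_⟩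
  · have := hg.isGaussian_map
    refine ⟨?_⟩
    have h2 : P.map (fun ω => X ω - m) = (P.map X).map (fun v => v - m) := by
      rw [Measure.map_map (by fun_prop) hX]; rfl
    rw [h2]
    infer_instance
  · simp only [Pi.sub_apply]
    rw [integral_sub (hint i) (integrable_const _), hmean]
    simp
  · simp only [Pi.sub_apply]
    rw [covariance_sub_const_left (hint i), covariance_sub_const_right (hint j),
      ← covariance_eval_multivariateGaussian (μ := WithLp.toLp 2 m) hN i j, ← h.map_eq,
      covariance_map_fun (by fun_prop) (by fun_prop) h.aemeasurable]

variable [IsProbabilityMeasure P]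

theorem integral_mul (h : IsCenteredGaussian P X N) (i j : Fin K) :
    ∫ ω, X ω i * X ω j ∂P = N i j := by
  have := covariance_eq_sub (h.memLp i) (h.memLp j)
  rw [h.covariance, h.mean, h.mean] at this
  simpa using this.symm

/-- A centered Gaussian vector, transformed linearly and perturbed by an independent one. -/
theorem mulVec_add {W : Ω → Fin K → ℝ} {V : Matrix (Fin K) (Fin K) ℝ}
    (h : IsCenteredGaussian P X N) (hW : IsCenteredGaussian P W V)
    (hind : IndepFun X W P) (A : Matrix (Fin K) (Fin K) ℝ) :
    IsCenteredGaussian P (fun ω => A *ᵥ X ω + W ω) (A * N * Aᵀ + V) := by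
  have hX := h.measurable
  have hWm := hW.measurable
  have hlin : ∀ i, MemLp (fun ω => ∑ j, A i j * X ω j) 2 P := fun i =>
    memLp_finsetSum _ fun j _ => (h.memLp j).const_mul _
  have hcross : ∀ i j, cov[fun ω => ∑ l, A i l * X ω l, fun ω => W ω j; P] = 0 := fun i j =>
    (hind.comp (φ := fun v : Fin K → ℝ => ∑ l, A i l * v l) (ψ := fun v : Fin K → ℝ => v j)
      (by fun_prop) (by fun_prop)).covariance_eq_zero (hlin i) (hW.memLp j)
  have happ : ∀ i, (fun ω => (A *ᵥ X ω + W ω) i)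
      = (fun ω => ∑ j, A i j * X ω j) + fun ω => W ω i := fun i => rfl
  refine ⟨?_, ?_, fun i => ?_, fun i j => ?_⟩
  · refine measurable_pi_iff.2 fun i => ?_
    rw [happ]
    fun_prop
  · have hg := hind.hasGaussianLaw h.gaussian hW.gaussian
    exact hg.map (((Matrix.mulVecLin A).toContinuousLinearMap.comp
      (ContinuousLinearMap.fst ℝ _ _)) + ContinuousLinearMap.snd ℝ _ _)
  · rw [happ, integral_add' ((hlin i).integrable (by norm_num)) (hW.integrable i), hW.mean,
      integral_finsetSum _ fun j _ => (h.integrable j).const_mul _]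
    simp [integral_const_mul, h.mean]
  · rw [happ, happ, covariance_add_left (hlin i) (hW.memLp i) ((hlin j).add (hW.memLp j)),
      covariance_add_right (hlin i) (hlin j) (hW.memLp j),
      covariance_add_right (hW.memLp i) (hlin j) (hW.memLp j), hcross,
      covariance_comm (fun ω => W ω i), hcross, hW.covariance,
      covariance_fun_sum_fun_sum (fun l => (h.memLp l).const_mul _)
        (fun l => (h.memLp l).const_mul _)]
    simp only [covariance_const_mul_left, covariance_const_mul_right, h.covariance, add_zero,
      zero_add, Matrix.add_apply, Matrix.mul_apply, Matrix.transpose_apply, Finset.sum_mul]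
    congr 1
    rw [Finset.sum_comm]
    exact Finset.sum_congr rfl fun l _ => Finset.sum_congr rfl fun m _ => by ring

end IsCenteredGaussian

/-- The correction step: if the prediction error `X` is independent of the past observations `H`
and the receiver noise `Z` is fresh, then the corrected error is independent of the past
observations and the innovation. -/
theorem IsCenteredGaussian.correct {S : Params K} [IsProbabilityMeasure P] {β : Type*}
    [MeasurableSpace β] {X : Ω → Fin K → ℝ} {N : Matrix (Fin K) (Fin K) ℝ} {Z : Ω → ℝ} {H : Ω → β}
    (h : IsCenteredGaussian P X N) (hZm : Measurable Z) (hZ : HasLaw Z (gaussianReal 0 S.σ2) P)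
    (hH : Measurable H) (hXH : IndepFun X H P) (hXHZ : IndepFun (fun ω => (X ω, H ω)) Z P) :
    IsCenteredGaussian P (fun ω => X ω - (S.b ⬝ᵥ X ω + Z ω) • S.gain N) (S.correctCov N) ∧
      IndepFun (fun ω => X ω - (S.b ⬝ᵥ X ω + Z ω) • S.gain N)
        (fun ω => (H ω, S.b ⬝ᵥ X ω + Z ω)) P := by
  set k := S.gain N with hk
  have hX := h.measurable
  have hXZ : IndepFun X Z P :=
    hXHZ.comp (φ := Prod.fst) (ψ := id) measurable_fst measurable_id
  have hZg : HasGaussianLaw Z P := hZ.hasGaussianLaw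
  have hlin : MemLp (fun ω => ∑ j, S.b j * X ω j) 2 P :=
    memLp_finsetSum _ fun j _ => (h.memLp j).const_mul _
  have hνfun : (fun ω => S.b ⬝ᵥ X ω + Z ω) = (fun ω => ∑ j, S.b j * X ω j) + Z := rfl
  have hν : MemLp (fun ω => S.b ⬝ᵥ X ω + Z ω) 2 P := hlin.add hZg.memLp_two
  have hνm : Measurable fun ω => S.b ⬝ᵥ X ω + Z ω := by
    rw [hνfun]
    fun_prop
  have hZmean : ∫ ω, Z ω ∂P = 0 := by
    have := hZ.integral_eq
    simpa using this
  have hZvar : cov[Z, Z; P] = S.σ2 := by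
    rw [covariance_self hZm.aemeasurable, hZ.variance_eq]
    simp
  have hνmean : ∫ ω, (S.b ⬝ᵥ X ω + Z ω) ∂P = 0 := by
    simp only [dotProduct]
    rw [integral_add (hlin.integrable (by norm_num)) hZg.integrable, hZmean,
      integral_finsetSum _ fun j _ => (h.integrable j).const_mul _]
    simp [integral_const_mul, h.mean]
  have hXZcov : ∀ i, cov[fun ω => X ω i, Z; P] = 0 := fun i =>
    (hXZ.comp (φ := fun v : Fin K → ℝ => v i) (ψ := id)
      (by fun_prop) measurable_id).covariance_eq_zero (h.memLp i) hZg.memLp_two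
  have hXν : ∀ i, cov[fun ω => X ω i, fun ω => S.b ⬝ᵥ X ω + Z ω; P] = (N *ᵥ S.b) i := by
    intro i
    rw [hνfun, covariance_add_right (h.memLp i) hlin hZg.memLp_two, hXZcov,
      covariance_fun_sum_right (fun l => (h.memLp l).const_mul _) (h.memLp i)]
    simp only [covariance_const_mul_right, h.covariance, mulVec, dotProduct, add_zero]
    exact Finset.sum_congr rfl fun l _ => mul_comm _ _
  have hZν : cov[Z, fun ω => S.b ⬝ᵥ X ω + Z ω; P] = S.σ2 := by
    rw [hνfun, covariance_add_right hZg.memLp_two hlin hZg.memLp_two, hZvar,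
      covariance_fun_sum_right (fun l => (h.memLp l).const_mul _) hZg.memLp_two]
    simp only [covariance_const_mul_right, covariance_comm Z (fun ω => X ω _), hXZcov, mul_zero,
      Finset.sum_const_zero, zero_add]
  have hνν : cov[fun ω => S.b ⬝ᵥ X ω + Z ω, fun ω => S.b ⬝ᵥ X ω + Z ω; P]
      = S.σ2 + S.b ⬝ᵥ (N *ᵥ S.b) := by
    conv_lhs => enter [1]; rw [hνfun]
    rw [covariance_add_left hlin hZg.memLp_two hν, hZν,
      covariance_fun_sum_left (fun l => (h.memLp l).const_mul _) hν]
    simp only [covariance_const_mul_left, hXν]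
    exact add_comm _ _
  -- The normal equation for the gain. If the innovation has variance zero, it vanishes almost
  -- surely, hence so does its covariance `N b` with `X`, and the convention `0⁻¹ = 0` is harmless.
  have hgain : ∀ i, k i * (S.σ2 + S.b ⬝ᵥ (N *ᵥ S.b)) = (N *ᵥ S.b) i := by
    intro i
    by_cases h0 : (S.σ2 : ℝ) + S.b ⬝ᵥ (N *ᵥ S.b) = 0
    · rw [h0, mul_zero]
      rw [h0, covariance_self hνm.aemeasurable] at hνν
      have hc : (fun ω => S.b ⬝ᵥ X ω + Z ω) =ᵐ[P] 0 := by
        have := (evariance_eq_zero_iff hνm.aemeasurable).1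
          (by rw [← hν.ofReal_variance_eq, hνν, ENNReal.ofReal_zero])
        rw [hνmean] at this
        exact this
      rw [← hXν i, ProbabilityTheory.covariance, hνmean]
      refine (integral_eq_zero_of_ae ?_).symm
      filter_upwards [hc] with ω hω
      simp only [Pi.zero_apply] at hω ⊢
      rw [hω]
      simp
    · simp only [hk, Params.gain, Pi.smul_apply, smul_eq_mul]
      field_simp
  have happ : ∀ i, (fun ω => (X ω - (S.b ⬝ᵥ X ω + Z ω) • k) i)
      = (fun ω => X ω i) - fun ω => k i * (S.b ⬝ᵥ X ω + Z ω) := fun i => by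
    ext ω
    simp [mul_comm]
  have heν : ∀ i, cov[fun ω => (X ω - (S.b ⬝ᵥ X ω + Z ω) • k) i,
      fun ω => S.b ⬝ᵥ X ω + Z ω; P] = 0 := by
    intro i
    rw [happ, covariance_sub_left (h.memLp i) (hν.const_mul _) hν, covariance_const_mul_left,
      hXν, hνν, hgain, sub_self]
  have hem : Measurable fun ω => X ω - (S.b ⬝ᵥ X ω + Z ω) • k := by fun_prop
  have hXZg := hXZ.hasGaussianLaw h.gaussian hZg
  -- The innovation as a linear functional of `(X, Z)`; error and innovation are then a linear image
  -- of a Gaussian pair.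
  let L : (Fin K → ℝ) × ℝ →L[ℝ] ℝ :=
    (∑ j, S.b j • ContinuousLinearMap.proj (R := ℝ) (φ := fun _ : Fin K => ℝ) j).comp
      (ContinuousLinearMap.fst ℝ _ _) + ContinuousLinearMap.snd ℝ _ _
  have hL : ∀ v r, L (v, r) = S.b ⬝ᵥ v + r := fun v r => by simp [L, dotProduct]
  have hjoint : HasGaussianLaw
      (fun ω => (X ω - (S.b ⬝ᵥ X ω + Z ω) • k, S.b ⬝ᵥ X ω + Z ω)) P := by
    have := hXZg.map_fun
      ((ContinuousLinearMap.fst ℝ _ _ - L.smulRight k).prod L)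
    simpa [hL] using this
  have hemem : ∀ i, MemLp (fun ω => (X ω - (S.b ⬝ᵥ X ω + Z ω) • k) i) 2 P := fun i =>
    (hjoint.fst.eval i).memLp_two
  refine ⟨⟨hem, hjoint.fst, fun i => ?_, fun i j => ?_⟩, ?_⟩
  · rw [happ, integral_sub' (h.integrable i) ((hν.integrable (by norm_num)).const_mul _),
      integral_const_mul, hνmean, h.mean]
    simp
  -- The corrected error is orthogonal to the innovation, so only its covariance with `X j` remains.
  · rw [happ j, covariance_sub_right (hemem i) (h.memLp j) (hν.const_mul _),
      covariance_const_mul_right, heν, happ i,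
      covariance_sub_left (h.memLp i) (hν.const_mul _) (h.memLp j), h.covariance,
      covariance_const_mul_left, covariance_comm, hXν]
    rw [Params.correctCov, ← hk, Matrix.sub_mul, Matrix.one_mul, Matrix.sub_apply,
      Matrix.mul_apply, mul_zero, sub_zero, mulVec, dotProduct, Finset.mul_sum]
    simp only [vecMulVec_apply]
    congr 1
    exact Finset.sum_congr rfl fun l _ => by rw [h.symm j l]; ring
  · have hind : IndepFun (fun ω => X ω - (S.b ⬝ᵥ X ω + Z ω) • k)
        (fun ω => S.b ⬝ᵥ X ω + Z ω) P := by
      -- The innovation is viewed as a family indexed by `Unit` to match the criterion that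
      -- uncorrelated jointly Gaussian families are independent.
      have h2 : HasGaussianLaw (fun ω => ((fun i => (X ω - (S.b ⬝ᵥ X ω + Z ω) • k) i),
          fun _ : Unit => S.b ⬝ᵥ X ω + Z ω)) P :=
        hjoint.map_fun ((ContinuousLinearMap.fst ℝ (Fin K → ℝ) ℝ).prod
          (ContinuousLinearMap.pi fun _ : Unit => ContinuousLinearMap.snd ℝ (Fin K → ℝ) ℝ))
      have h3 := h2.indepFun_of_covariance_eval fun i _ => heν i
      exact h3.comp (φ := id) (ψ := fun v : Unit → ℝ => v ()) measurable_id (by fun_prop)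
    -- Separate independence from `H` and from the innovation would not suffice. The pair (error,
    -- innovation) is a function of `(X, Z)`, hence jointly independent of `H`.
    have hpair : IndepFun (fun ω => (X ω - (S.b ⬝ᵥ X ω + Z ω) • k, S.b ⬝ᵥ X ω + Z ω)) H P := by
      have h4 : IndepFun H (fun ω => (X ω, Z ω)) P :=
        indepFun_prodMk_right hH hX hZm hXH.symm
          (hXHZ.comp (φ := Prod.swap) (ψ := id) measurable_swap measurable_id)
      have hdot : Measurable fun v : Fin K → ℝ => S.b ⬝ᵥ v := by
        simp only [dotProduct]
        fun_prop
      exact h4.symm.comp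
        (φ := fun p : (Fin K → ℝ) × ℝ => (p.1 - (S.b ⬝ᵥ p.1 + p.2) • k, S.b ⬝ᵥ p.1 + p.2))
        (ψ := id) (by fun_prop) measurable_id
    have h5 := indepFun_prodMk_right hem hνm hH hind hpair
    exact h5.comp (φ := id) (ψ := Prod.swap) measurable_id measurable_swap

end Gaussian

/-! ### Measurability of the filter -/

theorem measurable_mulVec {K : ℕ} (A : Matrix (Fin K) (Fin K) ℝ) :
    Measurable fun v : Fin K → ℝ => A *ᵥ v :=
  (Matrix.mulVecLin A).toContinuousLinearMap.continuous.measurable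

theorem measurable_dotProduct {K : ℕ} (b : Fin K → ℝ) :
    Measurable fun v : Fin K → ℝ => b ⬝ᵥ v := by
  simp only [dotProduct]
  fun_prop

theorem Params.measurable_estimate {K : ℕ} (S : Params K) (t : ℕ) :
    Measurable (S.estimate t) := by
  have hb := measurable_dotProduct S.b
  induction t with
  | zero =>
    simp only [Params.estimate, Params.correct]
    fun_prop
  | succ t ih =>
    have hinit : Measurable fun h : Fin (t + 1 + 1) → ℝ => (Fin.init h : Fin (t + 1) → ℝ) :=
      measurable_pi_iff.2 fun i => measurable_pi_apply _
    have hp : Measurable fun h : Fin (t + 1 + 1) → ℝ => S.A *ᵥ S.estimate t (Fin.init h) :=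
      (measurable_mulVec S.A).comp (ih.comp hinit)
    have hbp := hb.comp hp
    simp only [Function.comp_def] at hbp
    simp only [Params.estimate, Params.correct]
    fun_prop

/-! ### Independence structure of the model, the filter error and the computation MSE -/

namespace IsGaussMarkovModel

variable {K : ℕ} {S : Params K} {Ω : Type*} [MeasurableSpace Ω] {P : Measure Ω}
  {x w : ℕ → Ω → Fin K → ℝ} {y z : ℕ → Ω → ℝ}

/-- The initial state together with the process noises `w 0, …, w (t - 1)`. -/
def source (x w : ℕ → Ω → Fin K → ℝ) (t : ℕ) (ω : Ω) :
    (Fin K → ℝ) × (Finset.range t → Fin K → ℝ) :=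
  (x 0 ω, fun i => w i ω)

/-- Unrolling the recursion, `x s` uses only `x 0` and the noises before time `s`. This reduces
independence claims about states and observations to claims about the driving variables. -/
theorem measurable_state_source (hM : IsGaussMarkovModel S P x w y z) (t : ℕ) {s : ℕ}
    (hs : s ≤ t) : Measurable[MeasurableSpace.comap (source x w t) inferInstance] (x s) := by
  have hF : Measurable[MeasurableSpace.comap (source x w t) inferInstance] (source x w t) :=
    comap_measurable _
  induction s with
  | zero => exact measurable_fst.comp hF
  | succ s ih =>
    have hw : Measurable[MeasurableSpace.comap (source x w t) inferInstance] (w s) :=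
      ((measurable_pi_apply (⟨s, Finset.mem_range.2 hs⟩ : Finset.range t)).comp
        measurable_snd).comp hF
    have : x (s + 1) = fun ω => S.A *ᵥ x s ω + w s ω := funext (hM.state s)
    rw [this]
    exact ((measurable_mulVec S.A).comp (ih (by omega))).add hw

theorem measurable_source (hM : IsGaussMarkovModel S P x w y z) (t : ℕ) :
    Measurable (source x w t) :=
  hM.measurable_init.prodMk (measurable_pi_iff.2 fun i => hM.measurable_w i)

theorem measurable_state (hM : IsGaussMarkovModel S P x w y z) (t : ℕ) : Measurable (x t) :=
  (hM.measurable_state_source t le_rfl).mono (hM.measurable_source t).comap_le le_rfl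

theorem measurable_observation (hM : IsGaussMarkovModel S P x w y z) (t : ℕ) :
    Measurable (y t) := by
  have : y t = fun ω => S.b ⬝ᵥ x t ω + z t ω := funext (hM.observation t)
  rw [this]
  exact ((measurable_dotProduct S.b).comp (hM.measurable_state t)).add (hM.measurable_z t)

theorem measurable_history (hM : IsGaussMarkovModel S P x w y z) (t : ℕ) :
    Measurable (history y t) :=
  measurable_pi_iff.2 fun i => hM.measurable_observation i

variable [IsProbabilityMeasure P]

/-- The state `x t` and observations `y 0, …, y (t - 1)` are independent of the receiver
noise `z t`. -/
theorem indepFun_receiverNoise (hM : IsGaussMarkovModel S P x w y z) (t : ℕ) :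
    IndepFun (fun ω => (x t ω, fun i : Finset.range t => y i ω)) (z t) P := by
  have hz := hM.measurable_z
  have hpast : Measurable fun ω (i : Finset.range t) => z i ω :=
    measurable_pi_iff.2 fun i => hz i
  have h1 : IndepFun (fun ω (i : Finset.range t) => z i ω) (z t) P :=
    (hM.iIndep_z.indepFun_finset (Finset.range t) {t} (by simp) hz).comp
      (φ := id)
      (ψ := fun v : ({t} : Finset ℕ) → ℝ => v ⟨t, Finset.mem_singleton_self t⟩)
      measurable_id (by fun_prop)
  have h2 : IndepFun (source x w t) (fun ω => (fun i : Finset.range t => z i ω, z t ω)) P :=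
    hM.indep_init_w_z.comp
      (φ := fun p : (Fin K → ℝ) × (ℕ → Fin K → ℝ) => (p.1, fun i : Finset.range t => p.2 i))
      (ψ := fun v : ℕ → ℝ => (fun i : Finset.range t => v i, v t)) (by fun_prop) (by fun_prop)
  refine indepFun_of_measurable_comap
    (indepFun_prodMk_left (hM.measurable_source t) hpast (hz t) h1 h2) ?_
  have hF : Measurable[MeasurableSpace.comap
      (fun ω => (source x w t ω, fun i : Finset.range t => z i ω)) inferInstance]
      (fun ω => (source x w t ω, fun i : Finset.range t => z i ω)) := comap_measurable _
  have hx : ∀ s ≤ t, Measurable[MeasurableSpace.comap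
      (fun ω => (source x w t ω, fun i : Finset.range t => z i ω)) inferInstance] (x s) :=
    fun s hs => (hM.measurable_state_source t hs).mono (measurable_fst.comp hF).comap_le le_rfl
  refine Measurable.prodMk (hx t le_rfl) (@measurable_pi_iff _ _ _ (_) _ _ |>.2 fun i => ?_)
  have : y i = fun ω => S.b ⬝ᵥ x i ω + z i ω := funext (hM.observation i)
  rw [this]
  exact ((measurable_dotProduct S.b).comp (hx i (Finset.mem_range.1 i.2).le)).add
    (((measurable_pi_apply i).comp measurable_snd).comp hF)

/-- The state `x t` and observations `y 0, …, y t` are independent of the process noise `w t`. -/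
theorem indepFun_processNoise (hM : IsGaussMarkovModel S P x w y z) (t : ℕ) :
    IndepFun (fun ω => (x t ω, history y t ω)) (w t) P := by
  have hw := hM.measurable_w
  have hpast : Measurable fun ω (i : Finset.range t) => w i ω :=
    measurable_pi_iff.2 fun i => hw i
  have hzm : Measurable fun ω t => z t ω := measurable_pi_iff.2 hM.measurable_z
  have h1 : IndepFun (fun ω (i : Finset.range t) => w i ω) (w t) P :=
    (hM.iIndep_w.indepFun_finset (Finset.range t) {t} (by simp) hw).comp
      (φ := id)
      (ψ := fun v : ({t} : Finset ℕ) → Fin K → ℝ => v ⟨t, Finset.mem_singleton_self t⟩)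
      measurable_id (by fun_prop)
  have h2 : IndepFun (x 0) (fun ω => (fun i : Finset.range t => w i ω, w t ω)) P :=
    hM.indep_init_w.comp (φ := id)
      (ψ := fun v : ℕ → Fin K → ℝ => (fun i : Finset.range t => v i, v t))
      measurable_id (by fun_prop)
  have h3 : IndepFun (source x w t) (w t) P :=
    indepFun_prodMk_left hM.measurable_init hpast (hw t) h1 h2
  -- The entire receiver noise sequence can be adjoined, since it is independent of all process
  -- noise.
  have h4 : IndepFun (fun ω t => z t ω) (fun ω => (source x w t ω, w t ω)) P :=
    (hM.indep_init_w_z.comp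
      (φ := fun p : (Fin K → ℝ) × (ℕ → Fin K → ℝ) =>
        ((p.1, fun i : Finset.range t => p.2 i), p.2 t)) (ψ := id)
      (by fun_prop) measurable_id).symm
  refine indepFun_of_measurable_comap
    (indepFun_prodMk_left hzm (hM.measurable_source t) (hw t) h3 h4) ?_
  have hF : Measurable[MeasurableSpace.comap
      (fun ω => (fun t => z t ω, source x w t ω)) inferInstance]
      (fun ω => (fun t => z t ω, source x w t ω)) := comap_measurable _
  have hx : ∀ s ≤ t, Measurable[MeasurableSpace.comap
      (fun ω => (fun t => z t ω, source x w t ω)) inferInstance] (x s) :=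
    fun s hs => (hM.measurable_state_source t hs).mono (measurable_snd.comp hF).comap_le le_rfl
  refine Measurable.prodMk (hx t le_rfl) (@measurable_pi_iff _ _ _ (_) _ _ |>.2 fun i => ?_)
  have : (fun ω => history y t ω i) = fun ω => S.b ⬝ᵥ x i ω + z i ω := funext (hM.observation i)
  rw [this]
  exact ((measurable_dotProduct S.b).comp (hx i (Nat.lt_succ_iff.1 i.2))).add
    (((measurable_pi_apply (i : ℕ)).comp measurable_fst).comp hF)

/-- The error of the Kalman filter is a centered Gaussian vector with covariance `M_t`, and it is
independent of the observations. -/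
theorem filterError (hM : IsGaussMarkovModel S P x w y z) (t : ℕ) :
    IsCenteredGaussian P (fun ω => x t ω - S.estimate t (history y t ω)) (S.cov t) ∧
      IndepFun (fun ω => x t ω - S.estimate t (history y t ω)) (history y t) P := by
  induction t with
  | zero =>
    have hX := IsCenteredGaussian.of_hasLaw S.P₀_posSemidef hM.measurable_init hM.law_init
    -- Before the first observation the history is trivial, represented by a constant in `Unit`.
    have hind : IndepFun (fun ω => (x 0 ω - S.μ₀, ())) (z 0) P :=
      (hM.indepFun_receiverNoise 0).comp
        (φ := fun p : (Fin K → ℝ) × (Finset.range 0 → ℝ) => (p.1 - S.μ₀, ())) (ψ := id)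
        (by fun_prop) measurable_id
    obtain ⟨h1, h2⟩ := hX.correct (hM.measurable_z 0) (hM.law_z 0) measurable_const
      (indepFun_const_right _ ()) hind
    have herr : (fun ω => x 0 ω - S.estimate 0 (history y 0 ω)) =
        fun ω => x 0 ω - S.μ₀ - (S.b ⬝ᵥ (x 0 ω - S.μ₀) + z 0 ω) • S.gain S.P₀ := by
      funext ω
      have hy : history y 0 ω 0 = S.b ⬝ᵥ x 0 ω + z 0 ω := hM.observation 0 ω
      simp only [Params.estimate, Params.correct, Params.kalmanGain, Params.predCov, hy,
        dotProduct_sub]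
      module
    rw [herr]
    refine ⟨h1, ?_⟩
    have hhist : history y 0 = (fun p : Unit × ℝ => fun _ : Fin 1 => p.2 + S.b ⬝ᵥ S.μ₀) ∘
        fun ω => ((), S.b ⬝ᵥ (x 0 ω - S.μ₀) + z 0 ω) := by
      funext ω i
      have hi : i = 0 := Fin.fin_one_eq_zero i
      subst hi
      have hy : history y 0 ω 0 = S.b ⬝ᵥ x 0 ω + z 0 ω := hM.observation 0 ω
      simp only [Function.comp, hy, dotProduct_sub]
      ring
    rw [hhist]
    exact h2.comp (φ := id) measurable_id (by fun_prop)
  | succ t ih =>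
    obtain ⟨hE, hEind⟩ := ih
    have hest := S.measurable_estimate t
    have hb := measurable_dotProduct S.b
    have hA := measurable_mulVec S.A
    have hH := hM.measurable_history t
    have hW : IsCenteredGaussian P (w t) S.Vw := by
      have := IsCenteredGaussian.of_hasLaw (m := 0) S.Vw_posSemidef (hM.measurable_w t)
        (by simpa using hM.law_w t)
      simpa using this
    have hEHW : IndepFun (fun ω => (history y t ω, x t ω - S.estimate t (history y t ω)))
        (w t) P :=
      (hM.indepFun_processNoise t).comp
        (φ := fun p : (Fin K → ℝ) × (Fin (t + 1) → ℝ) => (p.2, p.1 - S.estimate t p.2)) (ψ := id)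
        (by fun_prop) measurable_id
    have hEW : IndepFun (fun ω => x t ω - S.estimate t (history y t ω)) (w t) P :=
      hEHW.comp (φ := Prod.snd) (ψ := id) measurable_snd measurable_id
    have hX := hE.mulVec_add hW hEW S.A
    have hXH : IndepFun (fun ω => S.A *ᵥ (x t ω - S.estimate t (history y t ω)) + w t ω)
        (history y t) P :=
      (indepFun_prodMk_right hH hE.measurable (hM.measurable_w t) hEind.symm hEHW).symm.comp
        (φ := fun p : (Fin K → ℝ) × (Fin K → ℝ) => S.A *ᵥ p.1 + p.2) (ψ := id)
        (by fun_prop) measurable_id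
    have hpred : ∀ ω, S.A *ᵥ (x t ω - S.estimate t (history y t ω)) + w t ω
        = x (t + 1) ω - S.A *ᵥ S.estimate t (history y t ω) := fun ω => by
      rw [hM.state, mulVec_sub]
      abel
    have hXHZ : IndepFun (fun ω => (S.A *ᵥ (x t ω - S.estimate t (history y t ω)) + w t ω,
        history y t ω)) (z (t + 1)) P := by
      simp_rw [hpred]
      exact (hM.indepFun_receiverNoise (t + 1)).comp
        (φ := fun p : (Fin K → ℝ) × (Finset.range (t + 1) → ℝ) =>
          (p.1 - S.A *ᵥ S.estimate t (fun i : Fin (t + 1) => p.2 ⟨i, Finset.mem_range.2 i.2⟩),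
            fun i : Fin (t + 1) => p.2 ⟨i, Finset.mem_range.2 i.2⟩))
        (ψ := id) (by fun_prop) measurable_id
    obtain ⟨h1, h2⟩ := hX.correct (hM.measurable_z (t + 1)) (hM.law_z (t + 1)) hH hXH hXHZ
    have herr : (fun ω => x (t + 1) ω - S.estimate (t + 1) (history y (t + 1) ω)) =
        fun ω => S.A *ᵥ (x t ω - S.estimate t (history y t ω)) + w t ω -
          (S.b ⬝ᵥ (S.A *ᵥ (x t ω - S.estimate t (history y t ω)) + w t ω) + z (t + 1) ω) •
            S.gain (S.predCov (t + 1)) := by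
      funext ω
      have hy : history y (t + 1) ω (Fin.last (t + 1)) = S.b ⬝ᵥ x (t + 1) ω + z (t + 1) ω :=
        hM.observation (t + 1) ω
      have hinit : (Fin.init (history y (t + 1) ω) : Fin (t + 1) → ℝ) = history y t ω := rfl
      simp only [Params.estimate, Params.correct, Params.kalmanGain, hy, hinit, hpred,
        dotProduct_sub]
      module
    rw [herr]
    refine ⟨h1, ?_⟩
    -- The new observation is the innovation plus its prediction `bᵀA x̂_t`, a function of the past;
    -- so independence from (past, innovation) gives independence from the new history.
    have hhist : history y (t + 1) = (fun p : (Fin (t + 1) → ℝ) × ℝ =>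
        (Fin.snoc p.1 (p.2 + S.b ⬝ᵥ (S.A *ᵥ S.estimate t p.1)) : Fin (t + 1 + 1) → ℝ)) ∘
        fun ω => (history y t ω,
          S.b ⬝ᵥ (S.A *ᵥ (x t ω - S.estimate t (history y t ω)) + w t ω) + z (t + 1) ω) := by
      funext ω i
      have hy : history y (t + 1) ω (Fin.last (t + 1)) = S.b ⬝ᵥ x (t + 1) ω + z (t + 1) ω :=
        hM.observation (t + 1) ω
      refine Fin.lastCases ?_ (fun j => ?_) i
      · simp only [Function.comp, Fin.snoc_last, hy, hpred, dotProduct_sub]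
        ring
      · simp only [Function.comp, Fin.snoc_castSucc]
        rfl
    rw [hhist]
    refine h2.comp (φ := id) measurable_id (measurable_pi_iff.2 fun i => ?_)
    refine Fin.lastCases ?_ (fun j => ?_) i
    · simp only [Fin.snoc_last]
      exact measurable_snd.add (hb.comp (hA.comp (hest.comp measurable_fst)))
    · simp only [Fin.snoc_castSucc]
      fun_prop

/-- The computation MSE of a policy exceeds the variance of the summed filter error by the squared
distance of its output to that of the Kalman policy. -/
theorem cmse_eq (hM : IsGaussMarkovModel S P x w y z) (t : ℕ) {π : (Fin (t + 1) → ℝ) → ℝ}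
    (hπ : Measurable π) :
    cmse P x y t π =ᵐ[P] fun ω => ENNReal.ofReal
      ((π (history y t ω) - S.kalmanPolicy t (history y t ω)) ^ 2
        + (1 : Fin K → ℝ) ⬝ᵥ (S.cov t *ᵥ 1)) := by
  obtain ⟨hE, hind⟩ := hM.filterError t
  set e := fun ω => x t ω - S.estimate t (history y t ω) with he
  have hest := S.measurable_estimate t
  have hem := hE.measurable
  have hκ : Measurable (S.kalmanPolicy t) := by
    unfold Params.kalmanPolicy
    fun_prop
  -- The sign comes from output minus truth: the independent part of `π - 1ᵀx_t` is `-1ᵀe`.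
  have hmean : ∫ ω, -∑ i, e ω i ∂P = 0 := by
    rw [integral_neg, integral_finsetSum _ fun i _ => hE.integrable i]
    simp [hE.mean]
  have hvar : ∫ ω, (-∑ i, e ω i) ^ 2 ∂P = (1 : Fin K → ℝ) ⬝ᵥ (S.cov t *ᵥ 1) := by
    have hsq : ∀ ω, (-∑ i, e ω i) ^ 2 = ∑ i, ∑ j, e ω i * e ω j := fun ω => by
      rw [neg_sq, sq, Finset.sum_mul_sum]
    simp_rw [hsq]
    have hij : ∀ i j, Integrable (fun ω => e ω i * e ω j) P := fun i j =>
      (hE.memLp i).integrable_mul (hE.memLp j)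
    rw [integral_finsetSum _ fun i _ => integrable_finsetSum _ fun j _ => hij i j]
    simp_rw [integral_finsetSum _ fun j _ => hij _ j, hE.integral_mul]
    simp [dotProduct, mulVec]
  have hs2 : MemLp (fun ω => -∑ i, e ω i) 2 P :=
    (memLp_finsetSum _ fun i _ => hE.memLp i).neg
  have hinds : IndepFun (history y t) (fun ω => -∑ i, e ω i) P :=
    hind.symm.comp (φ := id) (ψ := fun v : Fin K → ℝ => -∑ i, v i) measurable_id (by fun_prop)
  have key := condLExp_ofReal_add_sq (g := fun h => π h - S.kalmanPolicy t h)
    (hM.measurable_history t) (by fun_prop) (by fun_prop) hs2 hmean hinds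
  rw [hvar] at key
  refine Filter.EventuallyEq.trans (Filter.EventuallyEq.of_eq ?_) key
  unfold cmse
  congr 1
  funext ω
  rw [sq_abs]
  congr 2
  simp only [he, Params.kalmanPolicy, Pi.sub_apply, Finset.sum_sub_distrib]
  ring

/-- The quantity is the variance of the summed filter error, which avoids an algebraic proof that
`S.cov t` is positive semidefinite. -/
theorem cov_sum_nonneg (hM : IsGaussMarkovModel S P x w y z) (t : ℕ) :
    0 ≤ (1 : Fin K → ℝ) ⬝ᵥ (S.cov t *ᵥ 1) := by
  obtain ⟨hE, -⟩ := hM.filterError t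
  have h := variance_nonneg (fun ω => ∑ i, (x t ω - S.estimate t (history y t ω)) i) P
  rw [← covariance_self (Finset.aemeasurable_fun_sum _ fun i _ =>
    (hE.measurable_apply i).aemeasurable), covariance_fun_sum_fun_sum hE.memLp hE.memLp] at h
  simpa only [hE.covariance, dotProduct, mulVec, Pi.one_apply, one_mul, mul_one] using h

end IsGaussMarkovModel

end AirComp

/-! ### Optimality of the Kalman policy -/

theorem theorem1 {K : ℕ} (S : AirComp.Params K) {Ω : Type*} [MeasurableSpace Ω]
    (P : Measure Ω) [IsProbabilityMeasure P]
    (x w : ℕ → Ω → Fin K → ℝ) (y z : ℕ → Ω → ℝ)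
    (hmodel : AirComp.IsGaussMarkovModel S P x w y z) (t : ℕ) :
    -- the Kalman policy is an admissible policy
    Measurable (S.kalmanPolicy t) ∧
    -- it minimizes the computation MSE among all policies
    (∀ π : (Fin (t + 1) → ℝ) → ℝ, Measurable π →
      ∀ᵐ ω ∂P, AirComp.cmse P x y t (S.kalmanPolicy t) ω ≤ AirComp.cmse P x y t π ω) ∧
    -- its output is the only optimal one
    (∀ π : (Fin (t + 1) → ℝ) → ℝ, Measurable π →
      (∀ᵐ ω ∂P, AirComp.cmse P x y t π ω = AirComp.cmse P x y t (S.kalmanPolicy t) ω) →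
      ∀ᵐ ω ∂P, π (AirComp.history y t ω) = S.kalmanPolicy t (AirComp.history y t ω)) ∧
    -- the minimum is `1ᵀ M_t 1`
    (0 ≤ (1 : Fin K → ℝ) ⬝ᵥ (S.cov t *ᵥ 1) ∧
      ∀ᵐ ω ∂P, AirComp.cmse P x y t (S.kalmanPolicy t) ω =
        ENNReal.ofReal ((1 : Fin K → ℝ) ⬝ᵥ (S.cov t *ᵥ 1))) ∧
    -- `M_t` is the conditional error covariance matrix of the Kalman estimate
    (∀ i j : Fin K,
      Integrable (fun ω => (S.estimate t (AirComp.history y t ω) i - x t ω i) *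
        (S.estimate t (AirComp.history y t ω) j - x t ω j)) P ∧
      ∀ᵐ ω ∂P, condExp (AirComp.historyAlgebra y t) P
        (fun ω' => (S.estimate t (AirComp.history y t ω') i - x t ω' i) *
          (S.estimate t (AirComp.history y t ω') j - x t ω' j)) ω = S.cov t i j) := by
  have hκ : Measurable (S.kalmanPolicy t) := by
    have := S.measurable_estimate t
    unfold AirComp.Params.kalmanPolicy
    fun_prop
  have hκmse : ∀ᵐ ω ∂P, AirComp.cmse P x y t (S.kalmanPolicy t) ω =
      ENNReal.ofReal ((1 : Fin K → ℝ) ⬝ᵥ (S.cov t *ᵥ 1)) := by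
    filter_upwards [hmodel.cmse_eq t hκ] with ω hω
    rw [hω, sub_self, zero_pow two_ne_zero, zero_add]
  have hnonneg := hmodel.cov_sum_nonneg t
  refine ⟨hκ, fun π hπ => ?_, fun π hπ hopt => ?_, ⟨hnonneg, hκmse⟩, fun i j => ?_⟩
  · filter_upwards [hκmse, hmodel.cmse_eq t hπ] with ω h1 h2
    rw [h1, h2]
    exact ENNReal.ofReal_le_ofReal (le_add_of_nonneg_left (sq_nonneg _))
  · filter_upwards [hκmse, hmodel.cmse_eq t hπ, hopt] with ω h1 h2 h3
    -- Both arguments are nonnegative, so `ENNReal.ofReal` loses nothing and equality forces the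
    -- excess square to vanish.
    rw [h1, h2, ENNReal.ofReal_eq_ofReal_iff (add_nonneg (sq_nonneg _) hnonneg) hnonneg,
      add_eq_right] at h3
    exact sub_eq_zero.1 (pow_eq_zero_iff two_ne_zero |>.1 h3)
  · obtain ⟨hE, hind⟩ := hmodel.filterError t
    have hfun : (fun ω => (S.estimate t (AirComp.history y t ω) i - x t ω i) *
        (S.estimate t (AirComp.history y t ω) j - x t ω j)) =
        (fun v : Fin K → ℝ => v i * v j) ∘
          fun ω => x t ω - S.estimate t (AirComp.history y t ω) := by
      funext ω
      simp only [Function.comp, Pi.sub_apply]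
      ring
    have hprod : Measurable fun v : Fin K → ℝ => v i * v j := by fun_prop
    rw [hfun]
    refine ⟨(hE.memLp i).integrable_mul (hE.memLp j), ?_⟩
    have hcond := condExp_indep_eq hE.measurable.comap_le (hmodel.measurable_history t).comap_le
      (f := (fun v : Fin K → ℝ => v i * v j) ∘
          fun ω => x t ω - S.estimate t (AirComp.history y t ω))
      (hprod.comp (comap_measurable _)).stronglyMeasurable hind
    filter_upwards [hcond] with ω hω
    rw [hω]
    exact hE.integral_mul i j
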